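/- Theorem. There are an absolute constant $C>0$ and one fixed word-RAM program $P$ such that the following holds. Let $T[1..n]$, $n\ge 1$, be a string over the alphabet $[1..\sigma]$, let $\Gamma\subseteq\{1,\dots,n\}$ be a string attractor of $T$ of size $\gamma$ (that is, every nonempty substring $T[i..j]$ has an occurrence $T[i'..j']=T[i..j]$ such that $[i',j']$ contains an element of $\Gamma$), let $\tau\ge 2$ be an integer, and let the word size $w$ satisfy $n<2^w$ and $\sigma\le 2^w$. Then there is a static data structure for $T$ that consists of at most $$C\,\bigl(\gamma+\gamma\,\tau\log_\tau(n/\gamma)\bigr)$$ words of $w$ bits each, and on which $P$, given the starting position and the length $\ell$ of any substring of $T$, outputs that substring in packed form after at most $$C\,\bigl(1+\log_\tau(n/\gamma)+\ell\log_2(\sigma)/w\bigr)$$ steps. In particular, the space is $O(\gamma\tau\log_\tau(n/\gamma))$ words whenever $n\ge 2\gamma$, and the extraction time is $O(\log_\tau(n/\gamma)+\ell\log(\sigma)/w)$ whenever $n/\gamma\ge\tau$. Here the word RAM has a constant number of registers, performs addition, subtraction, multiplication, integer division and remainder (modulo $2^w$), bitwise operations, shifts, memory accesses and conditional jumps on $w$-bit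 words in one step each, and stores the data structure in a constant number of read-only arrays, each indexed by one word; the output is written to a separate working memory. A letter $c\in[1..\sigma]$ is encoded as the number $c-1$ with $b=\lceil\log_2\sigma\rceil$ bits, and packed form means that each word holds $\lfloor w/b\rfloor$ consecutive letters in consecutive $b$-bit fields (nothing has to be written if $\sigma=1$). -/

import Mathlib

/-- The substring of length `ℓ` of `T` that starts at position `i` (positions count from `0`). -/
def substring {α : Type*} {n : ℕ} (T : Fin n → α) (i ℓ : ℕ) (h : i + ℓ ≤ n) : Fin ℓ → α :=
  fun t => T ⟨i + t, by have := t.isLt; omega⟩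

/-- `Γ` is a string attractor of `T`: every nonempty substring of `T` has an occurrence that
contains a position of `Γ`. -/
def IsStringAttractor {α : Type*} {n : ℕ} (T : Fin n → α) (Γ : Finset (Fin n)) : Prop :=
  ∀ (i ℓ : ℕ) (h : i + ℓ ≤ n), 1 ≤ ℓ →
    ∃ (i' : ℕ) (h' : i' + ℓ ≤ n), substring T i' ℓ h' = substring T i ℓ h ∧
      ∃ j ∈ Γ, i' ≤ (j : ℕ) ∧ (j : ℕ) < i' + ℓ

namespace WordRAM

/-- The unit-cost arithmetic and bitwise operations on words. -/
inductive Op where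
  | add | sub | mul | div | mod | and | or | xor | shl | shr

/-- Operations on `w`-bit words: arithmetic is unsigned and modulo `2 ^ w`. -/
def Op.eval {w : ℕ} : Op → BitVec w → BitVec w → BitVec w
  | .add, x, y => x + y
  | .sub, x, y => x - y
  | .mul, x, y => x * y
  | .div, x, y => x / y
  | .mod, x, y => x % y
  | .and, x, y => x &&& y
  | .or, x, y => x ||| y
  | .xor, x, y => x ^^^ y
  | .shl, x, y => x <<< y.toNat
  | .shr, x, y => x >>> y.toNat

/-- Instructions. All arguments are literals of the program: names `d, a, b` of registers, a
constant `c`, the name `seg` of an array of the data structure, a jump target `t`. -/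
inductive Instr where
  /-- register `d` becomes the constant `c` modulo `2 ^ w` -/
  | const (d c : ℕ)
  /-- register `d` becomes the result of `o` on the registers `a` and `b` -/
  | op (o : Op) (d a b : ℕ)
  /-- register `d` becomes the word of array `seg` of the data structure whose index is in
  register `a` -/
  | read (seg d a : ℕ)
  /-- register `d` becomes the word of the working memory whose address is in register `a` -/
  | load (d a : ℕ)
  /-- the word of the working memory whose address is in register `a` becomes register `b` -/
  | store (a b : ℕ)
  /-- jump to instruction `t` if register `a` is smaller than register `b` -/
  | jlt (a b t : ℕ)
  /-- jump to instruction `t` -/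
  | jump (t : ℕ)
  /-- halt -/
  | halt

/-- A program: finitely many instructions, numbered from `0`. It does not depend on the word
size, nor on any input. -/
abbrev Program := List Instr

/-- A static (read-only) data structure: a list of arrays of `w`-bit words. -/
abbrev Data (w : ℕ) := List (List (BitVec w))

/-- The space of a data structure: its total number of words. -/
def Data.words {w : ℕ} (D : Data w) : ℕ := (D.map List.length).sum

/-- The word with index `a` of array `seg` (zero beyond the end of the array). -/
def Data.get {w : ℕ} (D : Data w) (seg : ℕ) (a : BitVec w) : BitVec w :=
  (D.getD seg []).getD a.toNat 0

/-- The configuration of the machine: program counter, registers, and writable working memory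
of `2 ^ w` words. -/
structure State (w : ℕ) where
  pc : ℕ
  reg : ℕ → BitVec w
  mem : BitVec w → BitVec w

/-- Write `x` into register `d` and go to the next instruction. -/
def State.setReg {w : ℕ} (s : State w) (d : ℕ) (x : BitVec w) : State w :=
  { s with pc := s.pc + 1, reg := Function.update s.reg d x }

/-- One step of the machine; `none` if the machine has halted. -/
def step {w : ℕ} (P : Program) (D : Data w) (s : State w) : Option (State w) :=
  match P[s.pc]? with
  | none => none
  | some .halt => none
  | some (.const d c) => some (s.setReg d (BitVec.ofNat w c))
  | some (.op o d a b) => some (s.setReg d (o.eval (s.reg a) (s.reg b)))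
  | some (.read seg d a) => some (s.setReg d (D.get seg (s.reg a)))
  | some (.load d a) => some (s.setReg d (s.mem (s.reg a)))
  | some (.store a b) =>
      some { s with pc := s.pc + 1, mem := Function.update s.mem (s.reg a) (s.reg b) }
  | some (.jlt a b t) =>
      some { s with pc := if (s.reg a).toNat < (s.reg b).toNat then t else s.pc + 1 }
  | some (.jump t) => some { s with pc := t }

/-- The configuration after exactly `t` steps; `none` if the machine halts earlier. -/
def run {w : ℕ} (P : Program) (D : Data w) : ℕ → State w → Option (State w)
  | 0, s => some s
  | t + 1, s => (step P D s).bind (run P D t)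

/-- The number `⌈log₂ σ⌉` of bits that encode one letter of an alphabet of size `σ`. -/
def bitsPerChar (σ : ℕ) : ℕ := Nat.clog 2 σ

/-- The number of letters that are packed into one `w`-bit word. -/
def charsPerWord (w σ : ℕ) : ℕ := w / bitsPerChar σ

/-- The working memory holds the string `S` in packed form from address `0` on: every word
contains `charsPerWord w σ` consecutive letters, in fields of `bitsPerChar σ` bits that start
at the least significant bit. -/
def HoldsPacked {w σ ℓ : ℕ} (mem : BitVec w → BitVec w) (S : Fin ℓ → Fin σ) : Prop :=
  ∀ t : Fin ℓ,
    (mem (BitVec.ofNat w ((t : ℕ) / charsPerWord w σ))).toNat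
        / 2 ^ (bitsPerChar σ * ((t : ℕ) % charsPerWord w σ)) % 2 ^ bitsPerChar σ
      = (S t : ℕ)

/-- On the data structure `D`, the program `P` extracts the substring of length `ℓ` of `T` at
position `i` within `time` steps. The arguments `i` and `ℓ` are passed in registers `0` and `1`;
all other registers and the working memory may have any content at the start. -/
def ExtractsWithin {w n σ : ℕ} (P : Program) (D : Data w) (T : Fin n → Fin σ)
    (i ℓ : ℕ) (h : i + ℓ ≤ n) (time : ℝ) : Prop :=
  ∀ s : State w, s.pc = 0 → s.reg 0 = BitVec.ofNat w i → s.reg 1 = BitVec.ofNat w ℓ →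
    ∃ (t : ℕ) (s' : State w), run P D t s = some s' ∧ step P D s' = none ∧
      (t : ℝ) ≤ time ∧ HoldsPacked s'.mem (substring T i ℓ h)

end WordRAM

/-!
The text is extracted in chunks. Fix a chunk length `m` and levels `0, …, L`, where level `0` is
the text itself and every other level consists of windows of the text around the attractor
positions, written one after the other. A level is cut into pieces of length `h k`, with
`h k = τ * h (k + 1)` and `h (L - 1) = m`, and the windows of level `k + 1` have radius `2 * h k`.
Two consecutive pieces of level `k`, cut to their window and to the text, form a substring of `T`
of length at most `2 * h k`. It has an occurrence that contains an attractor position, and this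
occurrence lies inside a window of level `k + 1`. So one number per piece suffices to redirect every
chunk that starts in the piece to a copy of itself on the next level (`exists_pointer`), and `L`
such steps lead to the last level, whose windows are stored in packed form (`exists_pointers`).

Each level has `O(γ * τ)` pieces. With `L` about `log_τ (n / γ)` and chunks of `L + 1` words, the
tables take `O(γ * τ * L)` words and the packed windows of length `4 * m` take `O(γ * L)` words. The
`O(L)` steps of a descent are paid for by the `L + 1` output words of its chunk, except for one
descent. `WordRAM.halts_extract` proves that `WordRAM.extractProgram` performs this computation;
a word of output is combined from two consecutive words of the packed text by shifts
(`getLsbD_unaligned`).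

Two details make the bounds hold without further assumptions. All numbers have to fit into words,
of which only `n < 2 ^ w` is known; the choice of `L` ensures `4 * γ * h 0 ≤ n`, so that every
position on every level is smaller than `n`. If the tables would have at least `n` words, or if no
level is needed, the text is stored in packed form instead (`exists_layout`). In the case
`n ≤ γ * τ`, Bernoulli's inequality `n ≤ γ + γ * τ * log_τ (n / γ)` shows that this is within the
space bound (`le_add_mul_logb`).
-/

/-! ### Windows around attractor positions -/

/-- The letter of `T` at position `x` as a number, and `0` outside of `T`. -/
def letter {n σ : ℕ} (T : Fin n → Fin σ) (x : ℕ) : ℕ :=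
  if h : x < n then (T ⟨x, h⟩ : ℕ) else 0

/-- A family of equally long windows of a text. Window `j < count` has `len` positions, and its
position with index `radius` is the text position `centre j`; a window may stick out of the text
on both sides. Position `p` of the concatenation of the windows belongs to window `p / len`. -/
structure Windows where
  centre : ℕ → ℕ
  radius : ℕ
  len : ℕ
  count : ℕ

/-- The `ℓ` positions of the concatenated windows from `p` on lie in one window and are the
positions from `x` on of a text of length `n`. -/
def Windows.Locates (F : Windows) (n p x ℓ : ℕ) : Prop :=
  p / F.len < F.count ∧ x + F.radius = F.centre (p / F.len) + p % F.len ∧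
    p % F.len + ℓ ≤ F.len ∧ x + ℓ ≤ n

theorem Windows.Locates.add_le {F : Windows} {n p x ℓ : ℕ} (H : F.Locates n p x ℓ) :
    p + ℓ ≤ F.count * F.len := by
  obtain ⟨h1, -, h3, -⟩ := H
  have h4 := Nat.div_add_mod p F.len
  have h5 := Nat.mul_le_mul_left F.len (Nat.succ_le_of_lt h1)
  rw [Nat.mul_succ] at h5
  rw [Nat.mul_comm F.count]
  omega

theorem Windows.Locates.letter_eq {F : Windows} {n p x ℓ t : ℕ} (H : F.Locates n p x ℓ)
    (ht : t < ℓ) : F.centre ((p + t) / F.len) + (p + t) % F.len - F.radius = x + t := by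
  obtain ⟨-, h2, h3, -⟩ := H
  have hdiv : (p + t) / F.len = p / F.len := by
    conv_lhs => rw [← Nat.mod_add_div p F.len, add_right_comm]
    rw [Nat.add_mul_div_left _ _ (by omega), Nat.div_eq_of_lt (by omega), zero_add]
  have hmod : (p + t) % F.len = p % F.len + t := by
    conv_lhs => rw [← Nat.mod_add_div p F.len, add_right_comm]
    rw [Nat.add_mul_mod_self_left, Nat.mod_eq_of_lt (by omega)]
  rw [hdiv, hmod]
  omega

/-- The windows of radius `2 * h` around the positions `g 0, …, g (γ - 1)`. -/
def windowsAround (g : ℕ → ℕ) (γ h : ℕ) : Windows := ⟨g, 2 * h, 4 * h, γ⟩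

/-- A block of length `2 * h` of a concatenation of windows, cut to its window and to the text, has
an occurrence near an attractor position, hence inside one of the windows of radius `2 * h` around
the attractor positions. One number `a` therefore redirects all fragments of length at most `h`
that start in the first half of the block. -/
theorem exists_pointer {n σ : ℕ} {T : Fin n → Fin σ} {Γ : Finset (Fin n)}
    (hΓ : IsStringAttractor T Γ) {g : ℕ → ℕ} {γ : ℕ} (hg : ∀ j ∈ Γ, ∃ e < γ, g e = (j : ℕ))
    (F : Windows) {h : ℕ} (hdvd : h ∣ F.len) (q : ℕ) :
    ∃ a, ∀ p x ℓ, p / h = q → 1 ≤ ℓ → ℓ ≤ h → F.Locates n p x ℓ →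
      ∃ x', (windowsAround g γ h).Locates n (a + p % h) x' ℓ ∧
        ∀ t < ℓ, letter T (x' + t) = letter T (x + t) := by
  obtain ⟨W, hW⟩ := hdvd
  set D := F.centre (q / W) + h * (q % W) with hD
  -- the block, cut to its window and to the text, is `[lo, hi)`
  set lo := D - F.radius with hlo
  set hi := min (min (D + 2 * h - F.radius) (D + (F.len - h * (q % W)) - F.radius)) n with hhi
  have key : ∀ p x ℓ, p / h = q → 1 ≤ ℓ → ℓ ≤ h → F.Locates n p x ℓ →
      x + F.radius = D + p % h ∧ x + ℓ ≤ hi ∧ p % h < h := by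
    intro p x ℓ hp hℓ hℓh ⟨h1, h2, h3, h4⟩
    have hr : p % h < h := Nat.mod_lt _ (by omega)
    have e1 : p / F.len = q / W := by rw [hW, ← Nat.div_div_eq_div_mul, hp]
    have e2 : p % F.len = p % h + h * (q % W) := by rw [hW, Nat.mod_mul, hp]
    rw [e1, e2] at h2
    rw [e2] at h3
    refine ⟨?_, ?_, hr⟩ <;> omega
  by_cases hlt : lo < hi
  · obtain ⟨i', h', hsub, j, hj, hj1, hj2⟩ := hΓ lo (hi - lo) (by omega) (by omega)
    obtain ⟨e, he, hge⟩ := hg j hj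
    refine ⟨e * (4 * h) + (i' + 2 * h - j - (F.radius - D)), ?_⟩
    intro p x ℓ hp hℓ hℓh hloc
    obtain ⟨k1, k2, k3⟩ := key p x ℓ hp hℓ hℓh hloc
    have hd : e * (4 * h) + (i' + 2 * h - j - (F.radius - D)) + p % h
        = (i' + 2 * h - j + (x - lo)) + e * (4 * h) := by omega
    have hb : i' + 2 * h - j + (x - lo) < 4 * h := by omega
    refine ⟨i' + (x - lo), ⟨?_, ?_, ?_, ?_⟩, ?_⟩
    · simp only [windowsAround]
      rw [hd, Nat.add_mul_div_right _ _ (by omega), Nat.div_eq_of_lt hb]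
      omega
    · simp only [windowsAround]
      rw [hd, Nat.add_mul_div_right _ _ (by omega), Nat.div_eq_of_lt hb, Nat.add_mul_mod_self_right,
        Nat.mod_eq_of_lt hb, Nat.zero_add, hge]
      omega
    · simp only [windowsAround]
      rw [hd, Nat.add_mul_mod_self_right, Nat.mod_eq_of_lt hb]
      omega
    · omega
    · intro t ht
      have := congrFun hsub ⟨x - lo + t, by omega⟩
      simp only [substring] at this
      have e1 : i' + (x - lo) + t < n := by omega
      have e2 : x + t < n := by omega
      simp only [letter, e1, e2, dite_true]
      have a1 : i' + (x - lo) + t = i' + (x - lo + t) := by omega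
      have a2 : x + t = lo + (x - lo + t) := by omega
      simp only [a1, a2, this]
  · refine ⟨0, fun p x ℓ hp hℓ hℓh hloc => ?_⟩
    obtain ⟨k1, k2, k3⟩ := key p x ℓ hp hℓ hℓh hloc
    omega

/-- The position reached from `x` after following the pointers `A` of `k` levels, where level `k`
is cut into pieces of length `h k`. -/
def follow (A : ℕ → ℕ → ℕ) (h : ℕ → ℕ) : ℕ → ℕ → ℕ
  | 0, x => x
  | k + 1, x => A k (follow A h k x / h k) + follow A h k x % h k

/-- The windows of each level: the whole text on level `0`, and windows around the attractor
positions on all others. -/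
def level (n : ℕ) (g : ℕ → ℕ) (γ : ℕ) (h : ℕ → ℕ) : ℕ → Windows
  | 0 => ⟨fun _ => 0, 0, h 0 * (n + 1), 1⟩
  | k + 1 => windowsAround g γ (h k)

/-- By induction on the levels, following the pointers from `x` leads to a copy of the chunk of
length `m` that starts there, or of the rest of the text if that is shorter. -/
theorem exists_pointers {n σ : ℕ} {T : Fin n → Fin σ} {Γ : Finset (Fin n)}
    (hΓ : IsStringAttractor T Γ) {g : ℕ → ℕ} {γ : ℕ} (hg : ∀ j ∈ Γ, ∃ e < γ, g e = (j : ℕ))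
    {L m : ℕ} {h : ℕ → ℕ} (hL : 1 ≤ L) (hm : 1 ≤ m) (hmh : ∀ k < L, m ≤ h k)
    (hdvd : ∀ k, k + 1 < L → h (k + 1) ∣ h k) :
    ∃ A : ℕ → ℕ → ℕ, ∀ x < n, ∀ k ≤ L, ∃ x',
      (level n g γ h k).Locates n (follow A h k x) x' (min m (n - x)) ∧
        ∀ t < min m (n - x), letter T (x' + t) = letter T (x + t) := by
  have hlen : ∀ k < L, h k ∣ (level n g γ h k).len := by
    rintro (_ | k) hk
    · exact dvd_mul_right _ _
    · exact (hdvd k hk).mul_left 4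
  have hstep : ∀ k q, ∃ a, k < L → ∀ p x ℓ, p / h k = q → 1 ≤ ℓ → ℓ ≤ h k →
      (level n g γ h k).Locates n p x ℓ →
      ∃ x', (windowsAround g γ (h k)).Locates n (a + p % h k) x' ℓ ∧
        ∀ t < ℓ, letter T (x' + t) = letter T (x + t) := by
    intro k q
    by_cases hk : k < L
    · obtain ⟨a, ha⟩ := exists_pointer hΓ hg (level n g γ h k) (hlen k hk) q
      exact ⟨a, fun _ => ha⟩
    · exact ⟨0, fun hk' => absurd hk' hk⟩
  choose A hA using hstep
  refine ⟨A, fun x hx k => ?_⟩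
  induction k with
  | zero =>
    intro _
    have h0 : n + 1 ≤ h 0 * (n + 1) := Nat.le_mul_of_pos_left _ (by have := hmh 0 hL; omega)
    refine ⟨x, ⟨?_, ?_, ?_, ?_⟩, fun t _ => rfl⟩
    · simp only [level, follow]
      rw [Nat.div_eq_of_lt (by omega)]; exact Nat.one_pos
    · simp only [level, follow]
      rw [Nat.mod_eq_of_lt (by omega)]; omega
    · simp only [level, follow]
      rw [Nat.mod_eq_of_lt (by omega)]; omega
    · omega
  | succ k ih =>
    intro hk
    obtain ⟨x₁, hloc, heq⟩ := ih (by omega)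
    have := hmh k (by omega)
    obtain ⟨x₂, hloc₂, heq₂⟩ :=
      hA k _ (by omega) _ x₁ _ rfl (by omega) (by omega) hloc
    exact ⟨x₂, hloc₂, fun t ht => (heq₂ t ht).trans (heq t ht)⟩

/-! ### Packed strings -/

/-- The `w`-bit word with number `u` of the packed form of the infinite string `V`: its letters
with numbers `u * c, …, u * c + c - 1` in fields of `b` bits, and zeros above. -/
def packWord (w c b : ℕ) (V : ℕ → ℕ) (u : ℕ) : BitVec w :=
  BitVec.ofFnLE fun z : Fin w => decide ((z : ℕ) < c * b) && (V (u * c + z / b)).testBit (z % b)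

theorem getLsbD_packWord {w c b : ℕ} (hcb : c * b ≤ w) (V : ℕ → ℕ) (u z : ℕ) :
    (packWord w c b V u).getLsbD z
      = (decide (z < c * b) && (V (u * c + z / b)).testBit (z % b)) := by
  rw [packWord, BitVec.getLsbD_ofFnLE]
  split_ifs with h
  · rfl
  · have : ¬ z < c * b := by omega
    simp [this]

/-- Two consecutive words of a packed string, shifted against each other, yield `c` letters that
start at an arbitrary position. -/
theorem getLsbD_unaligned {w c b : ℕ} (hcb : c * b ≤ w) (V : ℕ → ℕ) (u : ℕ) {o k j : ℕ}
    (ho : o < c) (hk : k < c) (hj : j < b) :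
    ((packWord w c b V u >>> (o * b)) ||| (packWord w c b V (u + 1) <<< ((c - o) * b))).getLsbD
      (b * k + j) = (V (u * c + o + k)).testBit j := by
  have hb : 0 < b := by omega
  have hfield : ∀ k', (b * k' + j) / b = k' ∧ (b * k' + j) % b = j := fun k' =>
    ⟨by rw [Nat.mul_add_div hb, Nat.div_eq_of_lt hj, add_zero],
      by rw [Nat.mul_add_mod, Nat.mod_eq_of_lt hj]⟩
  have hlt : ∀ k' a, k' < a → b * k' + j < a * b := by
    intro k' a h
    have := Nat.mul_le_mul_left b (Nat.succ_le_of_lt h)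
    rw [Nat.mul_succ] at this
    rw [Nat.mul_comm a]; omega
  have hge : ∀ k' a, a ≤ k' → a * b ≤ b * k' + j := by
    intro k' a h
    have := Nat.mul_le_mul_left b h
    rw [Nat.mul_comm a]; omega
  have hw : b * k + j < w := lt_of_lt_of_le (hlt k c hk) hcb
  rw [BitVec.getLsbD_or, BitVec.getLsbD_ushiftRight, BitVec.getLsbD_shiftLeft,
    getLsbD_packWord hcb, getLsbD_packWord hcb]
  have e1 : o * b + (b * k + j) = b * (o + k) + j := by ring
  rw [e1, (hfield (o + k)).1, (hfield (o + k)).2]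
  by_cases h : o + k < c
  · have h1 := hlt _ _ h
    have h2 := hlt k (c - o) (by omega)
    simp [h1, h2, add_assoc]
  · have h1 := hge (o + k) c (by omega)
    have h2 := hge k (c - o) (by omega)
    have e2 : b * k + j - (c - o) * b = b * (k - (c - o)) + j := by
      obtain ⟨d, rfl⟩ := Nat.exists_eq_add_of_le (show c - o ≤ k by omega)
      rw [Nat.add_sub_cancel_left, Nat.mul_add, Nat.mul_comm (c - o)]; omega
    have h3 := hlt (k - (c - o)) c (by omega)
    rw [e2, (hfield _).1, (hfield _).2]
    have e3 : (u + 1) * c + (k - (c - o)) = u * c + o + k := by rw [Nat.succ_mul]; omega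
    simp [h3, hw, e3, Nat.not_lt.mpr h1, Nat.not_lt.mpr h2]

theorem field_eq_of_getLsbD {w b k v : ℕ} (x : BitVec w) (hv : v < 2 ^ b)
    (h : ∀ j < b, x.getLsbD (b * k + j) = v.testBit j) :
    x.toNat / 2 ^ (b * k) % 2 ^ b = v := by
  apply Nat.eq_of_testBit_eq
  intro j
  rw [Nat.testBit_mod_two_pow, Nat.testBit_div_two_pow, add_comm j, BitVec.testBit_toNat]
  by_cases hj : j < b
  · simp [hj, h j hj]
  · have : v < 2 ^ j := lt_of_lt_of_le hv (Nat.pow_le_pow_right (by norm_num) (by omega))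
    simp [hj, Nat.testBit_lt_two_pow this]

/-! ### The extraction program -/

namespace WordRAM

/-- The program that extracts a substring. Registers `4` to `10` hold the parameters of the data
structure, `11` the number of words of the output, `12` the number of the next word. For each chunk
of the output, the loop at `23` follows the pointers of its first position down to the last level,
in registers `13` (position), `14` (index of the table of the level) and `15` (length of a piece);
the loop at `33` copies the chunk from the packed text, in register `16` the number of words to
go. -/
def extractProgram : Program :=
  [.const 2 0, .const 3 1, .read 0 4 2, .jlt 2 4 5, .halt,
   .jlt 2 1 7, .halt,
   .read 1 5 2, .read 2 6 2, .read 3 8 2, .read 4 9 2, .read 5 10 2, .op .mul 7 6 4,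
   .op .sub 11 1 3, .op .div 11 11 4, .op .add 11 11 3, .const 12 0,
   .jlt 12 11 19, .halt,
   .op .mul 13 12 4, .op .add 13 13 0, .const 14 0, .op .add 15 8 2,
   .jlt 15 7 32,
   .op .div 17 13 15, .op .mod 18 13 15, .op .add 17 17 14, .read 6 17 17, .op .add 13 17 18,
   .op .add 14 14 9, .op .div 15 15 10, .jump 23,
   .op .add 16 6 2,
   .jlt 2 16 35, .jump 17, .jlt 12 11 37, .halt,
   .op .div 17 13 4, .op .mod 18 13 4, .read 7 19 17, .op .add 17 17 3, .read 7 17 17,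
   .op .mul 20 18 5, .op .shr 19 19 20, .op .sub 18 4 18, .op .mul 18 18 5, .op .shl 17 17 18,
   .op .or 19 19 17, .store 12 19, .op .add 13 13 4, .op .add 12 12 3, .op .sub 16 16 3,
   .jump 33]

/-- Started in `s`, the machine halts after at most `B` steps with `Q`. -/
def HaltsWithin {w : ℕ} (P : Program) (D : Data w) (s : State w) (B : ℕ) (Q : State w → Prop) :
    Prop :=
  ∃ t s', run P D t s = some s' ∧ step P D s' = none ∧ t ≤ B ∧ Q s'

theorem run_add {w : ℕ} (P : Program) (D : Data w) (t u : ℕ) (s : State w) :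
    run P D (t + u) s = (run P D t s).bind (run P D u) := by
  induction t generalizing s with
  | zero => simp [run]
  | succ t ih =>
    rw [Nat.succ_add]
    simp only [run]
    cases step P D s with
    | none => rfl
    | some s₁ => exact ih s₁

theorem HaltsWithin.of_run {w : ℕ} {P : Program} {D : Data w} {s s₁ : State w} {t B B' : ℕ}
    {Q : State w → Prop} (h : HaltsWithin P D s₁ B Q) (hr : run P D t s = some s₁)
    (hB : t + B ≤ B') : HaltsWithin P D s B' Q := by
  obtain ⟨u, s', h1, h2, h3, h4⟩ := h
  exact ⟨t + u, s', by rw [run_add, hr]; exact h1, h2, by omega, h4⟩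

theorem HaltsWithin.of_step_eq_none {w : ℕ} {P : Program} {D : Data w} {s : State w}
    {Q : State w → Prop} (h : step P D s = none) (hQ : Q s) (B : ℕ) : HaltsWithin P D s B Q :=
  ⟨0, s, rfl, h, Nat.zero_le _, hQ⟩

theorem ofNat_div {w a b : ℕ} (ha : a < 2 ^ w) (hb : b < 2 ^ w) :
    BitVec.ofNat w a / BitVec.ofNat w b = BitVec.ofNat w (a / b) := by
  apply BitVec.eq_of_toNat_eq
  rw [BitVec.toNat_udiv]
  simp only [BitVec.toNat_ofNat]
  rw [Nat.mod_eq_of_lt ha, Nat.mod_eq_of_lt hb,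
    Nat.mod_eq_of_lt (lt_of_le_of_lt (Nat.div_le_self _ _) ha)]

theorem ofNat_mod {w a b : ℕ} (ha : a < 2 ^ w) (hb : b < 2 ^ w) :
    BitVec.ofNat w a % BitVec.ofNat w b = BitVec.ofNat w (a % b) := by
  apply BitVec.eq_of_toNat_eq
  rw [BitVec.toNat_umod]
  simp only [BitVec.toNat_ofNat]
  rw [Nat.mod_eq_of_lt ha, Nat.mod_eq_of_lt hb,
    Nat.mod_eq_of_lt (lt_of_le_of_lt (Nat.mod_le _ _) ha)]

theorem ofNat_sub {w a b : ℕ} (h : b ≤ a) :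
    BitVec.ofNat w a - BitVec.ofNat w b = BitVec.ofNat w (a - b) := by
  obtain ⟨d, rfl⟩ := Nat.exists_eq_add_of_le h
  rw [BitVec.ofNat_add, Nat.add_sub_cancel_left, add_sub_cancel_left]

/-- The parameters and the contents of the data structure: `c` letters per word, `b` bits per
letter, chunks of `v` words, `L` levels with pointer tables `A 0, …, A (L - 1)` of length `S` for
pieces of length `h₀`, `h₀ / τ`, …, and the first `N` letters of the string `V`, which is the
concatenation of the windows of the last level. -/
structure Layout where
  (c b v h₀ S τ L N : ℕ)
  A : ℕ → ℕ → ℕ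
  V : ℕ → ℕ

/-- The length of the pieces of level `k`. -/
def Layout.h (X : Layout) (k : ℕ) : ℕ := X.h₀ / X.τ ^ k

/-- The data structure with a given layout. The packed text has two words more than the full words
of `V`, so that the word after one that holds a letter of `V` is always present. -/
def Layout.data (X : Layout) (w : ℕ) : Data w :=
  [[BitVec.ofNat w X.c], [BitVec.ofNat w X.b], [BitVec.ofNat w X.v], [BitVec.ofNat w X.h₀],
   [BitVec.ofNat w X.S], [BitVec.ofNat w X.τ],
   (List.range (X.L * X.S)).map fun z => BitVec.ofNat w (X.A (z / X.S) (z % X.S)),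
   (List.range (X.N / X.c + 2)).map (packWord w X.c X.b X.V)]

theorem Layout.words_data (X : Layout) (w : ℕ) :
    (X.data w).words = 8 + X.L * X.S + X.N / X.c := by
  simp [Layout.data, Data.words]; omega

/-- The layout represents the string `str` of length `n`: all numbers that the program computes
fit into words, and following the pointers from any position leads to a copy of the chunk that
starts there. -/
structure Layout.Represents (X : Layout) (w n : ℕ) (str : ℕ → ℕ) : Prop where
  n_lt : n < 2 ^ w
  c_pos : 0 < X.c
  v_pos : 0 < X.v
  cb_le : X.c * X.b ≤ w
  chunk_lt : X.v * X.c < 2 ^ w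
  h₀_lt : X.h₀ < 2 ^ w
  τ_lt : X.τ < 2 ^ w
  table_lt : X.L * X.S < 2 ^ w
  chunk_le_h : ∀ k < X.L, X.v * X.c ≤ X.h k
  h_lt_chunk : X.h X.L < X.v * X.c
  follow_lt : ∀ x < n, ∀ k ≤ X.L, follow X.A X.h k x < n
  follow_div_lt : ∀ x < n, ∀ k < X.L, follow X.A X.h k x / X.h k < X.S
  N_le : X.N ≤ n
  text : ∀ x < n, ∀ t < X.v * X.c, x + t < n →
    follow X.A X.h X.L x + t < X.N ∧ X.V (follow X.A X.h X.L x + t) = str (x + t)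

/-- The registers that keep their contents after the initial part of the program; `i` is the start
and `U` the number of words of the output. -/
structure Frame {w : ℕ} (X : Layout) (i U : ℕ) (s : State w) : Prop where
  r0 : s.reg 0 = BitVec.ofNat w i
  r2 : s.reg 2 = BitVec.ofNat w 0
  r3 : s.reg 3 = BitVec.ofNat w 1
  r4 : s.reg 4 = BitVec.ofNat w X.c
  r5 : s.reg 5 = BitVec.ofNat w X.b
  r6 : s.reg 6 = BitVec.ofNat w X.v
  r7 : s.reg 7 = BitVec.ofNat w (X.v * X.c)
  r8 : s.reg 8 = BitVec.ofNat w X.h₀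
  r9 : s.reg 9 = BitVec.ofNat w X.S
  r10 : s.reg 10 = BitVec.ofNat w X.τ
  r11 : s.reg 11 = BitVec.ofNat w U

/-- The first `u` words of the working memory hold the substring of length `ℓ` of `str` from
position `i` on, as far as it fits. -/
def Written {w : ℕ} (X : Layout) (str : ℕ → ℕ) (i ℓ u : ℕ) (mem : BitVec w → BitVec w) : Prop :=
  ∀ u' < u, ∀ k < X.c, u' * X.c + k < ℓ → ∀ j < X.b,
    (mem (BitVec.ofNat w u')).getLsbD (X.b * k + j) = (str (i + (u' * X.c + k))).testBit j

theorem Layout.get_table {X : Layout} {w k q : ℕ} (hk : k < X.L) (hq : q < X.S)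
    (hw : X.L * X.S < 2 ^ w) :
    (X.data w).get 6 (BitVec.ofNat w (q + k * X.S)) = BitVec.ofNat w (X.A k q) := by
  have h1 : q + k * X.S < X.L * X.S := by
    have := Nat.mul_le_mul_right X.S (Nat.succ_le_of_lt hk)
    rw [Nat.succ_mul] at this; omega
  have h2 : (q + k * X.S) / X.S = k := by
    rw [Nat.add_mul_div_right _ _ (by omega), Nat.div_eq_of_lt hq, zero_add]
  have h3 : (q + k * X.S) % X.S = q := by
    rw [Nat.add_mul_mod_self_right, Nat.mod_eq_of_lt hq]
  simp [Layout.data, Data.get, Nat.mod_eq_of_lt (h1.trans hw), h1, h2, h3]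

theorem Layout.get_text {X : Layout} {w u : ℕ} (hu : u < X.N / X.c + 2) (hw : u < 2 ^ w) :
    (X.data w).get 7 (BitVec.ofNat w u) = packWord w X.c X.b X.V u := by
  simp [Layout.data, Data.get, Nat.mod_eq_of_lt hw, hu]

/-- The copying loop, with `v` words of the chunk to go: it costs `18` steps for each word that it
writes, and stops early at the end of the output. What happens after it has returned to the outer
loop is passed as the last hypothesis. -/
theorem halts_copy {w n i ℓ U B : ℕ} {X : Layout} {str : ℕ → ℕ} (hX : X.Represents w n str)
    (hU : U ≤ n) (hUℓ : ∀ u < U, u * X.c < ℓ) (v : ℕ) (hv : v ≤ X.v) :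
    ∀ (u q : ℕ) (s : State w), u ≤ U → s.pc = 33 → Frame X i U s →
    s.reg 12 = BitVec.ofNat w u → s.reg 13 = BitVec.ofNat w q → s.reg 16 = BitVec.ofNat w v →
    (∀ t < v * X.c, u * X.c + t < ℓ → q + t < X.N ∧ X.V (q + t) = str (i + (u * X.c + t))) →
    Written X str i ℓ u s.mem →
    (∀ s' : State w, u + v ≤ U → s'.pc = 17 → Frame X i U s' → s'.reg 12 = BitVec.ofNat w (u + v) →
      Written X str i ℓ (u + v) s'.mem →
      HaltsWithin extractProgram (X.data w) s' B fun s'' => Written X str i ℓ U s''.mem) →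
    HaltsWithin extractProgram (X.data w) s (B + 18 * min v (U - u) + 2)
      fun s'' => Written X str i ℓ U s''.mem := by
  have hn := hX.n_lt
  induction v with
  | zero =>
    intro u q ⟨pc, reg, mem⟩ hu hpc hF h12 _ h16 _ hW hcont
    obtain rfl : pc = 33 := hpc
    have h2 := hF.r2
    simp only at h2 h12 h16
    refine (hcont ⟨17, reg, mem⟩ hu rfl ⟨?_, ?_, ?_, ?_, ?_, ?_, ?_, ?_, ?_, ?_, ?_⟩ h12 hW).of_run
      (t := 2) ?_ (by omega)
    · exact hF.r0
    · exact hF.r2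
    · exact hF.r3
    · exact hF.r4
    · exact hF.r5
    · exact hF.r6
    · exact hF.r7
    · exact hF.r8
    · exact hF.r9
    · exact hF.r10
    · exact hF.r11
    · simp [run, step, extractProgram, h2, h16]
  | succ v ih =>
    intro u q ⟨pc, reg, mem⟩ hu hpc hF h12 h13 h16 hV hW hcont
    obtain rfl : pc = 33 := hpc
    have hc := hX.c_pos
    have hvw : v + 1 < 2 ^ w :=
      lt_of_le_of_lt (hv.trans (Nat.le_mul_of_pos_right _ hc)) hX.chunk_lt
    obtain ⟨f0, f2, f3, f4, f5, f6, f7, f8, f9, f10, f11⟩ := hF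
    simp only at f0 f2 f3 f4 f5 f6 f7 f8 f9 f10 f11 h12 h13 h16
    rcases Nat.eq_or_lt_of_le hu with rfl | hlt
    · -- the output is complete
      have : step extractProgram (X.data w) ⟨36, reg, mem⟩ = none := rfl
      refine (HaltsWithin.of_step_eq_none this hW 0).of_run (t := 2) ?_ (by omega)
      simp [run, step, extractProgram, f2, f11, h12, h16, Nat.mod_eq_of_lt hvw]
    · have huc := hUℓ u hlt
      obtain ⟨hqN, -⟩ := hV 0 (Nat.mul_pos (Nat.succ_pos _) hc) (by omega)
      have hqn : q + 1 < 2 ^ w := by have := hX.N_le; omega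
      have hcv : X.c ≤ X.v * X.c := Nat.le_mul_of_pos_left _ hX.v_pos
      have hcw : X.c < 2 ^ w := lt_of_le_of_lt hcv hX.chunk_lt
      have hdq : q / X.c ≤ q := Nat.div_le_self _ _
      have hqN' : q / X.c ≤ X.N / X.c := Nat.div_le_div_right (by omega)
      have hmod := Nat.mod_lt q hc
      -- all numbers that occur are small, so the word operations are those on `ℕ`
      have hww : w < 2 ^ w := Nat.lt_two_pow_self
      have hsh1 : q % X.c * X.b < 2 ^ w :=
        lt_of_le_of_lt ((Nat.mul_le_mul_right _ hmod.le).trans hX.cb_le) hww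
      have hsh2 : (X.c - q % X.c) * X.b < 2 ^ w :=
        lt_of_le_of_lt ((Nat.mul_le_mul_right _ (Nat.sub_le _ _)).trans hX.cb_le) hww
      have hrun : ∃ s₁ : State w, run extractProgram (X.data w) 18 ⟨33, reg, mem⟩ = some s₁ ∧
          s₁.pc = 33 ∧ Frame X i U s₁ ∧ s₁.reg 12 = BitVec.ofNat w (u + 1) ∧
          s₁.reg 13 = BitVec.ofNat w (q + X.c) ∧ s₁.reg 16 = BitVec.ofNat w v ∧
          s₁.mem = Function.update mem (BitVec.ofNat w u)
            ((packWord w X.c X.b X.V (q / X.c) >>> (q % X.c * X.b)) |||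
              (packWord w X.c X.b X.V (q / X.c + 1) <<< ((X.c - q % X.c) * X.b))) := by
        have hj1 : (reg 2).toNat < (reg 16).toNat := by
          simp [f2, h16, Nat.mod_eq_of_lt hvw]
        have hj2 : (reg 12).toNat < (reg 11).toNat := by
          simp only [h12, f11, BitVec.toNat_ofNat]
          rw [Nat.mod_eq_of_lt (by omega), Nat.mod_eq_of_lt (by omega)]; exact hlt
        have h2steps : run extractProgram (X.data w) 2 ⟨33, reg, mem⟩ = some ⟨37, reg, mem⟩ := by
          simp [run, step, extractProgram, hj1, hj2]
        rw [show 18 = 2 + 16 from rfl, run_add, h2steps]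
        refine ⟨_, rfl, rfl, ⟨f0, f2, f3, f4, f5, f6, f7, f8, f9, f10, f11⟩, ?_, ?_, ?_, ?_⟩
        · simp [State.setReg, Op.eval, h12, f3, BitVec.ofNat_add]
        · simp [State.setReg, Op.eval, h13, f4, BitVec.ofNat_add]
        · simp only [State.setReg, Op.eval, Function.update_apply]
          simp only [Nat.reduceEqDiff, if_true, if_false, h16, f3]
          exact ofNat_sub (by omega)
        · simp only [State.setReg, Op.eval, Function.update_apply]
          simp only [Nat.reduceEqDiff, if_true, if_false, h12, h13, f3, f4, f5,
            ofNat_div (show q < 2 ^ w by omega) hcw, ofNat_mod (show q < 2 ^ w by omega) hcw,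
            ofNat_sub hmod.le, ← BitVec.ofNat_add, ← BitVec.ofNat_mul]
          rw [Layout.get_text (by omega) (by omega), Layout.get_text (by omega) (by omega),
            BitVec.toNat_ofNat, BitVec.toNat_ofNat, Nat.mod_eq_of_lt hsh1, Nat.mod_eq_of_lt hsh2]
      obtain ⟨s₁, hr, g1, gF, g12, g13, g16, gmem⟩ := hrun
      refine (ih (by omega) (u + 1) (q + X.c) s₁ hlt g1 gF g12 g13 g16 ?_ ?_ ?_).of_run hr
        (by omega)
      · intro t ht htl
        rw [Nat.succ_mul] at htl
        have := hV (X.c + t) (by rw [Nat.succ_mul]; omega) (by omega)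
        rw [Nat.succ_mul, add_assoc q, add_assoc (u * X.c)]
        exact this
      · intro u' hu' k hk hkl j hj
        rw [gmem]
        rcases Nat.eq_or_lt_of_le (Nat.le_of_lt_succ hu') with rfl | hu''
        · rw [Function.update_self, getLsbD_unaligned hX.cb_le _ _ hmod hk hj, Nat.div_add_mod',
            (hV k (lt_of_lt_of_le hk (Nat.le_mul_of_pos_left _ (Nat.succ_pos _))) hkl).2]
        · have hne : BitVec.ofNat w u' ≠ BitVec.ofNat w u := by
            intro he
            have := congrArg BitVec.toNat he
            simp only [BitVec.toNat_ofNat] at this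
            rw [Nat.mod_eq_of_lt (by omega), Nat.mod_eq_of_lt (by omega)] at this
            omega
          rw [Function.update_of_ne hne]
          exact hW u' hu'' k hk hkl j hj
      · intro s' h1 h2 h3 h4 h5
        have e : u + 1 + v = u + (v + 1) := by omega
        rw [e] at h1 h4 h5
        exact hcont s' h1 h2 h3 h4 h5

/-- The descent from level `k` over the remaining `d` levels. -/
theorem run_descend {w n i x U : ℕ} {X : Layout} {str : ℕ → ℕ} (hX : X.Represents w n str)
    (hx : x < n) (d : ℕ) : ∀ (k u : ℕ) (s : State w), k + d = X.L → s.pc = 23 → Frame X i U s →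
    s.reg 12 = BitVec.ofNat w u → s.reg 13 = BitVec.ofNat w (follow X.A X.h k x) →
    s.reg 14 = BitVec.ofNat w (k * X.S) → s.reg 15 = BitVec.ofNat w (X.h k) →
    ∃ s', run extractProgram (X.data w) (9 * d + 1) s = some s' ∧ s'.pc = 32 ∧ Frame X i U s' ∧
      s'.reg 12 = BitVec.ofNat w u ∧
      s'.reg 13 = BitVec.ofNat w (follow X.A X.h X.L x) ∧ s'.mem = s.mem := by
  have hn := hX.n_lt
  have hhk : ∀ k, X.h k < 2 ^ w := fun k => lt_of_le_of_lt (Nat.div_le_self _ _) hX.h₀_lt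
  induction d with
  | zero =>
    intro k u ⟨pc, reg, mem⟩ hk hpc hF h12 h13 h14 h15
    obtain rfl : pc = 23 := hpc
    obtain rfl : k = X.L := hk
    obtain ⟨f0, f2, f3, f4, f5, f6, f7, f8, f9, f10, f11⟩ := hF
    have hj : (reg 15).toNat < (reg 7).toNat := by
      simp only at h15 f7
      simp only [h15, f7, BitVec.toNat_ofNat]
      rw [Nat.mod_eq_of_lt (hhk _), Nat.mod_eq_of_lt hX.chunk_lt]
      exact hX.h_lt_chunk
    exact ⟨⟨32, reg, mem⟩, by simp [run, step, extractProgram, hj], rfl,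
      ⟨f0, f2, f3, f4, f5, f6, f7, f8, f9, f10, f11⟩, h12, h13, rfl⟩
  | succ d ih =>
    intro k u ⟨pc, reg, mem⟩ hk hpc hF h12 h13 h14 h15
    obtain rfl : pc = 23 := hpc
    obtain ⟨f0, f2, f3, f4, f5, f6, f7, f8, f9, f10, f11⟩ := hF
    simp only at f0 f2 f3 f4 f5 f6 f7 f8 f9 f10 f11 h12 h13 h14 h15
    have hpw : follow X.A X.h k x < 2 ^ w := (hX.follow_lt x hx k (by omega)).trans hn
    have hrun : ∃ s₁ : State w, run extractProgram (X.data w) 9 ⟨23, reg, mem⟩ = some s₁ ∧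
        s₁.pc = 23 ∧ Frame X i U s₁ ∧ s₁.reg 12 = BitVec.ofNat w u ∧
        s₁.reg 13 = BitVec.ofNat w (follow X.A X.h (k + 1) x) ∧
        s₁.reg 14 = BitVec.ofNat w ((k + 1) * X.S) ∧ s₁.reg 15 = BitVec.ofNat w (X.h (k + 1)) ∧
        s₁.mem = mem := by
      have hj : ¬ (reg 15).toNat < (reg 7).toNat := by
        simp only [h15, f7, BitVec.toNat_ofNat]
        rw [Nat.mod_eq_of_lt (hhk _), Nat.mod_eq_of_lt hX.chunk_lt]
        exact not_lt.mpr (hX.chunk_le_h k (by omega))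
      have h1step : run extractProgram (X.data w) 1 ⟨23, reg, mem⟩ = some ⟨24, reg, mem⟩ := by
        simp [run, step, extractProgram, hj]
      rw [show 9 = 1 + 8 from rfl, run_add, h1step]
      refine ⟨_, rfl, rfl, ⟨f0, f2, f3, f4, f5, f6, f7, f8, f9, f10, f11⟩, h12, ?_, ?_, ?_, rfl⟩
      · simp only [State.setReg, Op.eval, Function.update_apply]
        simp only [Nat.reduceEqDiff, if_true, if_false, h13, h14, h15, ofNat_div hpw (hhk k),
          ofNat_mod hpw (hhk k), ← BitVec.ofNat_add]
        rw [Layout.get_table (by omega) (hX.follow_div_lt x hx k (by omega)) hX.table_lt,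
          ← BitVec.ofNat_add]
        rfl
      · simp [State.setReg, Op.eval, h14, f9, Nat.succ_mul,
          BitVec.ofNat_add]
      · simp only [State.setReg, Op.eval, Function.update_apply]
        simp only [Nat.reduceEqDiff, if_true, if_false, h15, f10, ofNat_div (hhk k) hX.τ_lt]
        rw [Layout.h, Layout.h, Nat.div_div_eq_div_mul, pow_succ]
    obtain ⟨s₁, hr, g1, gF, g12, g13, g14, g15, gm⟩ := hrun
    obtain ⟨s₂, hr₂, e1, e2, e3, e4, e5⟩ := ih (k + 1) u s₁ (by omega) g1 gF g12 g13 g14 g15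
    exact ⟨s₂, by rw [show 9 * (d + 1) + 1 = 9 + (9 * d + 1) by ring, run_add, hr]; exact hr₂,
      e1, e2, e3, e4, e5.trans gm⟩

/-- A chunk costs `9 * L + 9` steps apart from `18` steps for each of its words. -/
theorem halts_chunks {w n i ℓ U : ℕ} {X : Layout} {str : ℕ → ℕ} (hX : X.Represents w n str)
    (hiℓ : i + ℓ ≤ n) (hU : U ≤ n) (hUℓ : ∀ u < U, u * X.c < ℓ) (M : ℕ) :
    ∀ (u : ℕ) (s : State w), u ≤ U → U - u ≤ M * X.v → s.pc = 17 → Frame X i U s →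
    s.reg 12 = BitVec.ofNat w u → Written X str i ℓ u s.mem →
    HaltsWithin extractProgram (X.data w) s (M * (9 * X.L + 9) + 18 * (U - u) + 1)
      fun s'' => Written X str i ℓ U s''.mem := by
  have hn := hX.n_lt
  induction M with
  | zero =>
    intro u ⟨pc, reg, mem⟩ hu hM hpc hF h12 hW
    obtain rfl : pc = 17 := hpc
    obtain rfl : u = U := by omega
    have : step extractProgram (X.data w) ⟨18, reg, mem⟩ = none := rfl
    refine (HaltsWithin.of_step_eq_none this hW 0).of_run (t := 1) ?_ (by omega)
    have f11 := hF.r11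
    simp only at h12 f11
    simp [run, step, extractProgram, h12, f11]
  | succ M ih =>
    intro u ⟨pc, reg, mem⟩ hu hM hpc hF h12 hW
    obtain rfl : pc = 17 := hpc
    obtain ⟨f0, f2, f3, f4, f5, f6, f7, f8, f9, f10, f11⟩ := hF
    simp only at f0 f2 f3 f4 f5 f6 f7 f8 f9 f10 f11 h12
    rcases Nat.eq_or_lt_of_le hu with rfl | hlt
    · have : step extractProgram (X.data w) ⟨18, reg, mem⟩ = none := rfl
      refine (HaltsWithin.of_step_eq_none this hW 0).of_run (t := 1) ?_ (by omega)
      simp [run, step, extractProgram, h12, f11]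
    · have huc := hUℓ u hlt
      have hrun : ∃ s₁ : State w, run extractProgram (X.data w) 5 ⟨17, reg, mem⟩ = some s₁ ∧
          s₁.pc = 23 ∧ Frame X i U s₁ ∧ s₁.reg 12 = BitVec.ofNat w u ∧
          s₁.reg 13 = BitVec.ofNat w (u * X.c + i) ∧ s₁.reg 14 = BitVec.ofNat w (0 * X.S) ∧
          s₁.reg 15 = BitVec.ofNat w (X.h 0) ∧ s₁.mem = mem := by
        have hj : (reg 12).toNat < (reg 11).toNat := by
          simp only [h12, f11, BitVec.toNat_ofNat]
          rw [Nat.mod_eq_of_lt (by omega), Nat.mod_eq_of_lt (by omega)]; exact hlt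
        have h1step : run extractProgram (X.data w) 1 ⟨17, reg, mem⟩ = some ⟨19, reg, mem⟩ := by
          simp [run, step, extractProgram, hj]
        rw [show 5 = 1 + 4 from rfl, run_add, h1step]
        refine ⟨_, rfl, rfl, ⟨f0, f2, f3, f4, f5, f6, f7, f8, f9, f10, f11⟩, h12, ?_, ?_, ?_, rfl⟩
        · simp [State.setReg, Op.eval, h12, f4, f0, BitVec.ofNat_add,
            BitVec.ofNat_mul]
        · simp [State.setReg]
        · simp [State.setReg, Op.eval, f2, f8, Layout.h]
      obtain ⟨s₁, hr₁, a1, aF, a12, a13, a14, a15, am⟩ := hrun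
      have hxn : u * X.c + i < n := by omega
      obtain ⟨⟨pc₂, reg₂, mem₂⟩, hr₂, c1, cF, c12, c13, cm⟩ :=
        run_descend hX hxn X.L 0 u s₁ (by omega) a1 aF a12 a13 a14 a15
      obtain rfl : pc₂ = 32 := c1
      obtain ⟨f0, f2, f3, f4, f5, f6, f7, f8, f9, f10, f11⟩ := cF
      simp only at f0 f2 f3 f4 f5 f6 f7 f8 f9 f10 f11 c12 c13 cm
      have hrun : ∃ s₃ : State w, run extractProgram (X.data w) 1 ⟨32, reg₂, mem₂⟩ = some s₃ ∧
          s₃.pc = 33 ∧ Frame X i U s₃ ∧ s₃.reg 12 = BitVec.ofNat w u ∧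
          s₃.reg 13 = BitVec.ofNat w (follow X.A X.h X.L (u * X.c + i)) ∧
          s₃.reg 16 = BitVec.ofNat w X.v ∧ s₃.mem = mem₂ := by
        refine ⟨_, rfl, rfl, ⟨f0, f2, f3, f4, f5, f6, f7, f8, f9, f10, f11⟩, c12, c13, ?_, rfl⟩
        simp [State.setReg, Op.eval, f6, f2]
      obtain ⟨s₃, hr₃, d1, dF, d12, d13, d16, dm⟩ := hrun
      have hM' : U - u - X.v ≤ M * X.v := by rw [Nat.succ_mul] at hM; omega
      have := halts_copy (B := M * (9 * X.L + 9) + 18 * (U - u - X.v) + 1) hX hU hUℓ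
        X.v le_rfl u _ s₃ hu d1 dF d12 d13 d16 ?_ ?_ ?_
      · refine ((this.of_run hr₃ le_rfl).of_run hr₂ le_rfl).of_run hr₁ ?_
        have := Nat.add_one_mul M (9 * X.L + 9)
        omega
      · intro t ht htℓ
        have := hX.text _ hxn t ht (by omega)
        rw [show u * X.c + i + t = i + (u * X.c + t) by ring] at this
        exact this
      · rw [dm, cm, am]; exact hW
      · intro s' h1 h2 h3 h4 h5
        rw [Nat.sub_sub]
        rw [Nat.sub_sub] at hM'
        exact ih (u + X.v) s' h1 hM' h2 h3 h4 h5

/-- The number of steps is linear in the number of levels for each chunk, plus the number of words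
of the output. -/
theorem halts_extract {w n i ℓ : ℕ} {X : Layout} {str : ℕ → ℕ} (hX : X.Represents w n str)
    (hiℓ : i + ℓ ≤ n) (s : State w) (hpc : s.pc = 0) (h0 : s.reg 0 = BitVec.ofNat w i)
    (h1 : s.reg 1 = BitVec.ofNat w ℓ) :
    HaltsWithin extractProgram (X.data w) s
      ((ℓ / X.c / X.v + 1) * (9 * X.L + 9) + 18 * (ℓ / X.c + 1) + 16)
      fun s' => ∀ t < ℓ, ∀ j < X.b,
        (s'.mem (BitVec.ofNat w (t / X.c))).getLsbD (X.b * (t % X.c) + j)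
          = (str (i + t)).testBit j := by
  obtain ⟨pc, reg, mem⟩ := s
  obtain rfl : pc = 0 := hpc
  simp only at h0 h1
  have hn := hX.n_lt
  have hc := hX.c_pos
  have hcw : X.c < 2 ^ w := lt_of_le_of_lt (Nat.le_mul_of_pos_left _ hX.v_pos) hX.chunk_lt
  have hrun : ∃ reg₁ : ℕ → BitVec w,
      run extractProgram (X.data w) 4 ⟨0, reg, mem⟩ = some ⟨5, reg₁, mem⟩ ∧
      reg₁ 0 = BitVec.ofNat w i ∧ reg₁ 1 = BitVec.ofNat w ℓ ∧ reg₁ 2 = BitVec.ofNat w 0 ∧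
      reg₁ 3 = BitVec.ofNat w 1 ∧ reg₁ 4 = BitVec.ofNat w X.c := by
    have h3steps : run extractProgram (X.data w) 3 ⟨0, reg, mem⟩ = some ⟨3,
        Function.update (Function.update (Function.update reg 2 (BitVec.ofNat w 0)) 3
          (BitVec.ofNat w 1)) 4 (BitVec.ofNat w X.c), mem⟩ := by
      simp [run, step, extractProgram, State.setReg, Layout.data, Data.get]
    refine ⟨Function.update (Function.update (Function.update reg 2 (BitVec.ofNat w 0)) 3
      (BitVec.ofNat w 1)) 4 (BitVec.ofNat w X.c), ?_, by simpa using h0, by simpa using h1,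
      by simp, by simp, by simp⟩
    rw [show 4 = 3 + 1 from rfl, run_add, h3steps]
    simp [run, step, extractProgram, Nat.mod_eq_of_lt hcw, hc]
  obtain ⟨reg₁, hr₁, g0, g1, g2, g3, g4⟩ := hrun
  rcases Nat.eq_zero_or_pos ℓ with rfl | hℓ
  · have : step extractProgram (X.data w) ⟨6, reg₁, mem⟩ = none := rfl
    refine ((HaltsWithin.of_step_eq_none this ?_ 0).of_run (t := 1) ?_ le_rfl).of_run hr₁
      (by omega)
    · intro t ht; omega
    · simp [run, step, extractProgram, g1, g2]
  · set U := (ℓ - 1) / X.c + 1 with hUdef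
    have hUle : U ≤ ℓ / X.c + 1 :=
      Nat.succ_le_succ (Nat.div_le_div_right (Nat.sub_le _ _))
    have hUn : U ≤ n := by
      have := Nat.div_le_self (ℓ - 1) X.c
      omega
    have hUℓ : ∀ u < U, u * X.c < ℓ := by
      intro u hu
      have := (Nat.le_div_iff_mul_le hc).mp (Nat.le_of_lt_succ hu)
      omega
    have hrun : ∃ s₂ : State w, run extractProgram (X.data w) 11 ⟨5, reg₁, mem⟩ = some s₂ ∧
        s₂.pc = 17 ∧ Frame X i U s₂ ∧ s₂.reg 12 = BitVec.ofNat w 0 ∧ s₂.mem = mem := by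
      have hj : (reg₁ 2).toNat < (reg₁ 1).toNat := by
        simp only [g1, g2, BitVec.toNat_ofNat]
        rw [Nat.zero_mod, Nat.mod_eq_of_lt (by omega)]; exact hℓ
      have h1step : run extractProgram (X.data w) 1 ⟨5, reg₁, mem⟩ = some ⟨7, reg₁, mem⟩ := by
        simp [run, step, extractProgram, hj]
      rw [show 11 = 1 + 10 from rfl, run_add, h1step]
      refine ⟨_, rfl, rfl, ⟨g0, g2, g3, g4, ?_, ?_, ?_, ?_, ?_, ?_, ?_⟩, ?_, rfl⟩
      · simp [State.setReg, g2, Layout.data, Data.get]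
      · simp [State.setReg, g2, Layout.data, Data.get]
      · simp [State.setReg, Op.eval, g2, g4, Layout.data, Data.get,
          BitVec.ofNat_mul]
      · simp [State.setReg, g2, Layout.data, Data.get]
      · simp [State.setReg, g2, Layout.data, Data.get]
      · simp [State.setReg, g2, Layout.data, Data.get]
      · simp only [State.setReg, Op.eval, Function.update_apply]
        simp only [Nat.reduceEqDiff, if_true, if_false, g1, g3, g4]
        rw [ofNat_sub (by omega), ofNat_div (by omega) hcw, ← BitVec.ofNat_add]
      · simp [State.setReg]
    obtain ⟨s₂, hr₂, a1, aF, a12, am⟩ := hrun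
    have hchunks : U - 0 ≤ (ℓ / X.c / X.v + 1) * X.v := by
      have := Nat.lt_div_mul_add (a := ℓ / X.c) hX.v_pos
      rw [Nat.succ_mul]; omega
    obtain ⟨t, s', k1, k2, k3, k4⟩ := ((halts_chunks hX hiℓ hUn hUℓ (ℓ / X.c / X.v + 1) 0 s₂
      (Nat.zero_le _) hchunks a1 aF a12 (fun u' hu' => absurd hu' (Nat.not_lt_zero _))).of_run hr₂
      le_rfl).of_run hr₁ le_rfl
    refine ⟨t, s', k1, k2, by omega, fun z hz j hj => ?_⟩
    have := k4 (z / X.c) (Nat.lt_succ_of_le (Nat.div_le_div_right (by omega))) (z % X.c)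
      (Nat.mod_lt _ hc) (by rw [Nat.div_add_mod']; exact hz) j hj
    rw [Nat.div_add_mod'] at this
    exact this

end WordRAM

/-! ### Layouts of the data structure -/

namespace WordRAM

/-- The layout without pointers, which stores the whole string `str` in packed form. -/
def plainLayout (n c b : ℕ) (str : ℕ → ℕ) : Layout := ⟨c, b, 1, 0, 0, 0, 0, n, fun _ _ => 0, str⟩

theorem plainLayout_represents {w n c b : ℕ} (hn : n < 2 ^ w) (hc : 0 < c) (hcw : c ≤ w)
    (hcb : c * b ≤ w) (str : ℕ → ℕ) : (plainLayout n c b str).Represents w n str where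
  n_lt := hn
  c_pos := hc
  v_pos := Nat.one_pos
  cb_le := hcb
  chunk_lt := by
    simpa [plainLayout] using lt_of_le_of_lt hcw Nat.lt_two_pow_self
  h₀_lt := by simp [plainLayout]
  τ_lt := by simp [plainLayout]
  table_lt := by simp [plainLayout]
  chunk_le_h k hk := absurd hk (Nat.not_lt_zero k)
  h_lt_chunk := by simpa [plainLayout, Layout.h] using hc
  follow_lt x hx k hk := by
    obtain rfl : k = 0 := Nat.le_zero.mp hk
    exact hx
  follow_div_lt x hx k hk := absurd hk (Nat.not_lt_zero k)
  N_le := le_rfl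
  text x hx t ht hxt := ⟨hxt, rfl⟩

/-- With `k + 1` levels of pieces whose lengths are `v * c * τ ^ k, …, v * c`, the pointers given by
a string attractor represent the text. -/
theorem exists_layout_represents {w n σ τ c b v k : ℕ} {T : Fin n → Fin σ} {Γ : Finset (Fin n)}
    (hΓ : IsStringAttractor T Γ) (hn : n < 2 ^ w) (hτ : 2 ≤ τ) (hγ : 1 ≤ Γ.card) (hc : 0 < c)
    (hv : 0 < v) (hcb : c * b ≤ w) (htable : (k + 1) * (8 * Γ.card * τ + 1) ≤ n)
    (hsmall : 4 * Γ.card * (v * c * τ ^ k) ≤ n)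
    (hlarge : n ≤ 8 * Γ.card * (v * c * τ ^ (k + 1))) :
    ∃ X : Layout, X.Represents w n (letter T) ∧ X.c = c ∧ X.b = b ∧ X.v = v ∧ X.L = k + 1 ∧
      X.S = 8 * Γ.card * τ + 1 ∧ X.N = 4 * Γ.card * (v * c) := by
  set γ := Γ.card with hγdef
  obtain ⟨g, hg⟩ : ∃ g : ℕ → ℕ, ∀ j ∈ Γ, ∃ e < γ, g e = (j : ℕ) := by
    refine ⟨fun e => if h : e < γ then (Γ.equivFin.symm ⟨e, h⟩ : Fin n) else 0, fun j hj => ?_⟩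
    refine ⟨Γ.equivFin ⟨j, hj⟩, (Γ.equivFin ⟨j, hj⟩).isLt, ?_⟩
    simp [hγdef]
  set m := v * c with hm
  have hm0 : 0 < m := Nat.mul_pos hv hc
  have hτ0 : 0 < τ := by omega
  set h : ℕ → ℕ := fun j => m * τ ^ k / τ ^ j with hh
  have hval : ∀ j ≤ k, h j = m * τ ^ (k - j) := fun j hj => by
    rw [hh]; simp only
    rw [Nat.mul_div_assoc _ (pow_dvd_pow τ hj), Nat.pow_div hj hτ0]
  have hsucc : ∀ j, j + 1 ≤ k → h j = h (j + 1) * τ := fun j hj => by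
    rw [hval j (by omega), hval (j + 1) hj, show k - j = k - (j + 1) + 1 by omega, pow_succ]
    ring
  have hmle : ∀ j < k + 1, m ≤ h j := fun j hj => by
    rw [hval j (by omega)]; exact Nat.le_mul_of_pos_right _ (pow_pos hτ0 _)
  have hle : ∀ j, h j ≤ m * τ ^ k := fun j => Nat.div_le_self _ _
  obtain ⟨A, hA⟩ := exists_pointers hΓ hg (L := k + 1) (by omega) hm0 hmle
    (fun j hj => ⟨τ, hsucc j (by omega)⟩)
  -- a position on level `j + 1` lies in one of the `γ` windows of length `4 * h j`
  have hpos : ∀ x < n, ∀ j < k + 1, follow A h (j + 1) x < γ * (4 * h j) := by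
    intro x hx j hj
    obtain ⟨x', hloc, -⟩ := hA x hx (j + 1) hj
    have := hloc.add_le
    simp only [level, windowsAround] at this
    omega
  refine ⟨⟨c, b, v, m * τ ^ k, 8 * γ * τ + 1, τ, k + 1, 4 * γ * m, A, fun p =>
    letter T (g (p / (4 * h k)) + p % (4 * h k) - 2 * h k)⟩, ?_, rfl, rfl, rfl, rfl, rfl, rfl⟩
  have hkm : h k = m := by rw [hval k le_rfl]; simp
  have hmn : m * τ ^ k ≤ n :=
    (Nat.le_mul_of_pos_left _ (by omega)).trans hsmall
  refine ⟨hn, hc, hv, hcb, ?_, lt_of_le_of_lt hmn hn, ?_, lt_of_le_of_lt htable hn, hmle, ?_, ?_,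
    ?_, ?_, ?_⟩
  · exact lt_of_le_of_lt ((hmle 0 (by omega)).trans ((hle 0).trans hmn)) hn
  · show τ < 2 ^ w
    have h1 : τ ≤ 8 * γ * τ := Nat.le_mul_of_pos_left _ (by omega)
    have h2 : 8 * γ * τ + 1 ≤ (k + 1) * (8 * γ * τ + 1) := Nat.le_mul_of_pos_left _ (by omega)
    omega
  · show m * τ ^ k / τ ^ (k + 1) < m
    rw [Nat.div_lt_iff_lt_mul (pow_pos hτ0 _)]
    exact Nat.mul_lt_mul_of_pos_left (Nat.pow_lt_pow_right hτ (Nat.lt_succ_self k)) hm0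
  · rintro x hx (_ | j) hj
    · exact hx
    · have h1 := hpos x hx j hj
      have h2 := Nat.mul_le_mul_left (4 * γ) (hle j)
      calc follow A h (j + 1) x < γ * (4 * h j) := h1
        _ = 4 * γ * h j := by ring
        _ ≤ n := h2.trans hsmall
  · rintro x hx (_ | j) hj
    · show x / h 0 < 8 * γ * τ + 1
      rw [Nat.div_lt_iff_lt_mul (lt_of_lt_of_le hm0 (hmle 0 hj)), hval 0 (Nat.zero_le _)]
      calc x < n := hx
        _ ≤ 8 * γ * τ * (m * τ ^ (k - 0)) := hlarge.trans_eq (by rw [Nat.sub_zero]; ring)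
        _ ≤ _ := Nat.mul_le_mul_right _ (Nat.le_succ _)
    · show follow A h (j + 1) x / h (j + 1) < 8 * γ * τ + 1
      have hj' : j + 1 < k + 1 := hj
      rw [Nat.div_lt_iff_lt_mul (lt_of_lt_of_le hm0 (hmle _ hj'))]
      calc follow A h (j + 1) x < γ * (4 * h j) := hpos x hx j (by omega)
        _ = 4 * γ * τ * h (j + 1) := by rw [hsucc j (by omega)]; ring
        _ ≤ _ := Nat.mul_le_mul_right _ (by rw [mul_assoc, mul_assoc]; omega)
  · show 4 * γ * m ≤ n
    exact (Nat.mul_le_mul_left _ (hkm ▸ hle k)).trans hsmall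
  · intro x hx t ht hxt
    obtain ⟨x', hloc, heq⟩ := hA x hx (k + 1) le_rfl
    have ht' : t < min m (n - x) := lt_min ht (by omega)
    have hadd := hloc.add_le
    have hlet := hloc.letter_eq ht'
    simp only [level, windowsAround] at hadd hlet
    rw [hkm] at hadd
    refine ⟨?_, ?_⟩
    · show follow A h (k + 1) x + t < 4 * γ * m
      have : γ * (4 * m) = 4 * γ * m := by ring
      omega
    · show letter T (g ((follow A h (k + 1) x + t) / (4 * h k))
        + (follow A h (k + 1) x + t) % (4 * h k) - 2 * h k) = letter T (x + t)
      rw [hlet]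
      exact heq t ht'

/-- On a layout that represents `T`, with the letters of `T` in fields of the right size, the
program outputs any substring in packed form. -/
theorem Layout.Represents.extractsWithin {w n σ i ℓ : ℕ} {T : Fin n → Fin σ} {X : Layout}
    (hX : X.Represents w n (letter T)) (hc : X.c = charsPerWord w σ) (hb : X.b = bitsPerChar σ)
    (h : i + ℓ ≤ n) {time : ℝ}
    (htime : (((ℓ / X.c / X.v + 1) * (9 * X.L + 9) + 18 * (ℓ / X.c + 1) + 16 : ℕ) : ℝ) ≤ time) :
    ExtractsWithin extractProgram (X.data w) T i ℓ h time := by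
  intro s hpc h0 h1
  obtain ⟨t, s', k1, k2, k3, k4⟩ := halts_extract hX h s hpc h0 h1
  refine ⟨t, s', k1, k2, le_trans (by exact_mod_cast k3) htime, fun z => ?_⟩
  have hlt : ((substring T i ℓ h z : Fin σ) : ℕ) < 2 ^ bitsPerChar σ :=
    (substring T i ℓ h z).isLt.trans_le (Nat.le_pow_clog (by norm_num) σ)
  refine field_eq_of_getLsbD _ hlt fun j hj => ?_
  rw [← hb] at hj ⊢
  rw [← hc, k4 z z.isLt j hj]
  have : i + (z : ℕ) < n := by have := z.isLt; omega
  simp only [letter, this, dite_true, substring]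

/-- If there is only one letter, the program reads that no letter fits into a word, and halts. -/
theorem extractsWithin_nil {w n : ℕ} (T : Fin n → Fin 1) {i ℓ : ℕ} (h : i + ℓ ≤ n) {time : ℝ}
    (htime : 4 ≤ time) : ExtractsWithin (w := w) extractProgram [] T i ℓ h time := by
  rintro ⟨pc, reg, mem⟩ hpc h0 h1
  obtain rfl : pc = 0 := hpc
  refine ⟨4, _, rfl, ?_, by exact_mod_cast htime, fun t => ?_⟩
  · simp [step, extractProgram, State.setReg, Data.get]
  · have hb : bitsPerChar 1 = 0 := by simp [bitsPerChar]
    rw [hb, pow_zero, Nat.mod_one]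
    omega

end WordRAM

/-! ### Estimates -/

section Bounds

variable {n γ τ : ℕ}

theorem le_logb_of_mul_pow_le (hγ : 1 ≤ γ) (hτ : 2 ≤ τ) {k : ℕ} (h : γ * τ ^ k ≤ n) :
    (k : ℝ) ≤ Real.logb τ ((n : ℝ) / γ) := by
  have hγ' : (0 : ℝ) < γ := by exact_mod_cast hγ
  have hτ' : (1 : ℝ) < τ := by exact_mod_cast hτ
  have h' : (γ : ℝ) * τ ^ k ≤ n := by exact_mod_cast h
  have hpos : (0 : ℝ) < (τ : ℝ) ^ k := by positivity
  rw [Real.le_logb_iff_rpow_le hτ' (div_pos (lt_of_lt_of_le (mul_pos hγ' hpos) h') hγ'),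
    Real.rpow_natCast, le_div_iff₀ hγ']
  linarith

/-- Bernoulli's inequality `τ ^ x ≤ 1 + (τ - 1) * x` for `x = log_τ (n / γ) ≤ 1`. -/
theorem le_add_mul_logb (hγ : 1 ≤ γ) (hτ : 2 ≤ τ) (hn : γ ≤ n) (h : n ≤ γ * τ) :
    (n : ℝ) ≤ γ + γ * τ * Real.logb τ ((n : ℝ) / γ) := by
  have hγ' : (0 : ℝ) < γ := by exact_mod_cast hγ
  have hτ' : (1 : ℝ) < τ := by exact_mod_cast hτ
  have hn' : (γ : ℝ) ≤ n := by exact_mod_cast hn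
  have h' : (n : ℝ) ≤ γ * τ := by exact_mod_cast h
  have hq : (0 : ℝ) < (n : ℝ) / γ := div_pos (by linarith) hγ'
  set x := Real.logb τ ((n : ℝ) / γ) with hx
  have hx0 : 0 ≤ x := Real.logb_nonneg hτ' (by rwa [le_div_iff₀ hγ', one_mul])
  have hx1 : x ≤ 1 := by
    rw [hx, Real.logb_le_iff_le_rpow hτ' hq, Real.rpow_one, div_le_iff₀ hγ']
    linarith
  have hb := rpow_one_add_le_one_add_mul_self (s := (τ : ℝ) - 1) (by linarith) hx0 hx1
  rw [add_sub_cancel, hx, Real.rpow_logb (by linarith) hτ'.ne' hq, ← hx, div_le_iff₀ hγ'] at hb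
  nlinarith [mul_nonneg hγ'.le hx0]

/-- Rounding down the number of letters per word and rounding up the number of bits per letter
cost at most a factor of two each. -/
theorem div_charsPerWord_le {w σ ℓ : ℕ} (hσ : 2 ≤ σ) (hw : σ ≤ 2 ^ w) :
    ((ℓ / WordRAM.charsPerWord w σ : ℕ) : ℝ) ≤ 4 * (ℓ * Real.logb 2 σ / w) := by
  set b := WordRAM.bitsPerChar σ with hb
  set c := WordRAM.charsPerWord w σ with hc
  have hb1 : 1 ≤ b := Nat.clog_pos (by norm_num) hσ
  have hbw : b ≤ w := Nat.clog_le_of_le_pow hw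
  have hc1 : 1 ≤ c := Nat.div_pos hbw hb1
  have hbl : (b : ℝ) ≤ 2 * Real.logb 2 σ := by
    have hpow : 1 * 2 ^ (b - 1) ≤ σ := by
      rw [one_mul]; exact (Nat.pow_pred_clog_lt_self (by norm_num) hσ).le
    have h1 := le_logb_of_mul_pow_le le_rfl le_rfl hpow
    have h2 := le_logb_of_mul_pow_le (k := 1) le_rfl le_rfl (show 1 * 2 ^ 1 ≤ σ by simpa using hσ)
    rw [Nat.cast_one, div_one] at h1 h2
    rw [Nat.cast_sub hb1] at h1
    push_cast at h1 h2
    linarith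
  have hwcb : (w : ℝ) ≤ 2 * (c * b) := by
    have h1 : w < c * b + b := Nat.lt_div_mul_add hb1
    have h2 : b ≤ c * b := Nat.le_mul_of_pos_left _ hc1
    have h3 : w ≤ 2 * (c * b) := by omega
    exact_mod_cast h3
  have hc' : (0 : ℝ) < c := by exact_mod_cast hc1
  have hw' : (0 : ℝ) < w := by exact_mod_cast (show 0 < w by omega)
  refine Nat.cast_div_le.trans ?_
  rw [← mul_div_assoc, div_le_div_iff₀ hc' hw']
  have hℓ : (0 : ℝ) ≤ ℓ := Nat.cast_nonneg _
  have h1 : (w : ℝ) ≤ 4 * Real.logb 2 σ * c := by nlinarith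
  nlinarith

end Bounds

theorem IsStringAttractor.card_pos {α : Type*} {n : ℕ} {T : Fin n → α} {Γ : Finset (Fin n)}
    (hΓ : IsStringAttractor T Γ) (hn : 1 ≤ n) : 1 ≤ Γ.card := by
  obtain ⟨_, _, _, j, hj, _⟩ := hΓ 0 1 (by omega) le_rfl
  exact Finset.card_pos.mpr ⟨j, hj⟩

/-! ### Space and time -/

/-- The choice of the number of levels. The pieces of the first level have length about
`n / (γ * τ)` and those of the last level, which are the chunks, consist of `L + 1` words. If no
levels are needed, or if the tables would be as large as the text, the text is stored without
pointers. -/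
theorem exists_layout {w n σ τ : ℕ} {T : Fin n → Fin σ} {Γ : Finset (Fin n)}
    (hΓ : IsStringAttractor T Γ) (hn1 : 1 ≤ n) (hn : n < 2 ^ w) (hσ : 2 ≤ σ) (hσw : σ ≤ 2 ^ w)
    (hτ : 2 ≤ τ) :
    ∃ X : WordRAM.Layout, X.Represents w n (letter T) ∧ X.c = WordRAM.charsPerWord w σ ∧
      X.b = WordRAM.bitsPerChar σ ∧ X.v = X.L + 1 ∧
      (X.L : ℝ) ≤ Real.logb τ ((n : ℝ) / Γ.card) + 1 ∧
      ((X.data w).words : ℝ) ≤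
        30 * ((Γ.card : ℝ) + (Γ.card : ℝ) * τ * Real.logb τ ((n : ℝ) / Γ.card)) := by
  have hγ := hΓ.card_pos hn1
  have hγn : Γ.card ≤ n := by simpa using Γ.card_le_univ
  set γ := Γ.card
  set b := WordRAM.bitsPerChar σ
  set c := WordRAM.charsPerWord w σ
  have hb1 : 1 ≤ b := Nat.clog_pos (by norm_num) hσ
  have hc1 : 1 ≤ c := Nat.div_pos (Nat.clog_le_of_le_pow hσw) hb1
  have hcw : c ≤ w := Nat.div_le_self _ _
  have hcb : c * b ≤ w := Nat.div_mul_le_self _ _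
  have hx0 := le_logb_of_mul_pow_le (k := 0) hγ hτ (by simpa using hγn)
  set x := Real.logb τ ((n : ℝ) / γ)
  rw [Nat.cast_zero] at hx0
  have hγ' : (1 : ℝ) ≤ γ := by exact_mod_cast hγ
  have hτ' : (2 : ℝ) ≤ τ := by exact_mod_cast hτ
  have hγτ : (2 : ℝ) * γ ≤ γ * τ := by nlinarith
  have hγx : 0 ≤ γ * τ * x := by positivity
  have hex : ∃ L, n ≤ 8 * γ * c * (L + 1) * τ ^ L := by
    refine ⟨n, (Nat.lt_pow_self hτ).le.trans (Nat.le_mul_of_pos_left _ ?_)⟩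
    positivity
  have hfind := Nat.find_spec hex
  rcases hL : Nat.find hex with _ | k
  · rw [hL] at hfind
    refine ⟨_, WordRAM.plainLayout_represents hn hc1 hcw hcb (letter T), rfl, rfl, rfl, ?_, ?_⟩
    · simp only [WordRAM.plainLayout]; push_cast; linarith
    · rw [WordRAM.Layout.words_data]
      have hnc : n / c ≤ 8 * γ := by
        refine Nat.div_le_of_le_mul (hfind.trans_eq ?_)
        ring
      have : ((n / c : ℕ) : ℝ) ≤ 8 * γ := by exact_mod_cast hnc
      simp only [WordRAM.plainLayout]
      push_cast at this ⊢
      nlinarith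
  · have hmin := not_le.mp (Nat.find_min hex (m := k) (by omega))
    rw [hL] at hfind
    have hkx : (k : ℝ) ≤ x := by
      refine le_logb_of_mul_pow_le hγ hτ (le_trans ?_ hmin.le)
      refine Nat.mul_le_mul_right _ ?_
      calc γ = γ * 1 * 1 := by ring
        _ ≤ 8 * γ * c * (k + 1) :=
          Nat.mul_le_mul (Nat.mul_le_mul (by omega) hc1) (by omega)
    have hxcases : n ≤ γ * τ ∨ 1 ≤ x := by
      rcases le_total n (γ * τ) with h | h
      · exact Or.inl h
      · refine Or.inr ?_
        have := le_logb_of_mul_pow_le (n := n) (k := 1) hγ hτ (by rwa [pow_one])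
        simpa only [Nat.cast_one] using this
    have htab : 1 ≤ x → ((k : ℝ) + 1) * (8 * γ * τ + 1) ≤ 18 * (γ * τ * x) := by
      intro hx1
      calc ((k : ℝ) + 1) * (8 * γ * τ + 1) ≤ (2 * x) * (9 * (γ * τ)) := by
            refine mul_le_mul (by linarith) (by linarith) (by positivity) (by linarith)
        _ = 18 * (γ * τ * x) := by ring
    by_cases hS : (k + 1) * (8 * γ * τ + 1) ≤ n
    · have hsmall : 4 * γ * ((k + 2) * c * τ ^ k) ≤ n := by
        refine le_trans ?_ hmin.le
        calc 4 * γ * ((k + 2) * c * τ ^ k) = (4 * (k + 2)) * (γ * c * τ ^ k) := by ring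
          _ ≤ (8 * (k + 1)) * (γ * c * τ ^ k) := Nat.mul_le_mul_right _ (by omega)
          _ = _ := by ring
      have hlarge : n ≤ 8 * γ * ((k + 2) * c * τ ^ (k + 1)) := hfind.trans_eq (by ring)
      obtain ⟨X, hX, h1, h2, h3, h4, h5, h6⟩ :=
        WordRAM.exists_layout_represents hΓ hn hτ hγ hc1 (Nat.succ_pos (k + 1)) hcb hS hsmall hlarge
      refine ⟨X, hX, h1, h2, by rw [h3, h4], by rw [h4]; push_cast; linarith, ?_⟩
      have hx1 : 1 ≤ x := by
        refine hxcases.resolve_left fun h => ?_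
        have e1 : 8 * γ * τ + 1 ≤ (k + 1) * (8 * γ * τ + 1) :=
          Nat.le_mul_of_pos_left _ (Nat.succ_pos k)
        have e2 : 8 * γ * τ = 8 * (γ * τ) := by ring
        omega
      have hN : X.N / X.c = 4 * γ * (k + 2) := by
        rw [h6, h1, ← mul_assoc, Nat.mul_div_cancel _ hc1]
      rw [WordRAM.Layout.words_data, hN, h4, h5]
      have h18 := htab hx1
      have h12 : 4 * (γ : ℝ) * (k + 2) ≤ 6 * (γ * τ * x) := by
        calc 4 * (γ : ℝ) * (k + 2) ≤ 4 * γ * (3 * x) := by gcongr; linarith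
          _ = 6 * (2 * γ * x) := by ring
          _ ≤ 6 * (γ * τ * x) := by gcongr
      push_cast
      linarith
    · refine ⟨_, WordRAM.plainLayout_represents hn hc1 hcw hcb (letter T), rfl, rfl, rfl, ?_, ?_⟩
      · simp only [WordRAM.plainLayout]; push_cast; linarith
      · have hnb : (n : ℝ) ≤ γ + 18 * (γ * τ * x) := by
          rcases hxcases with h | h
          · have := le_add_mul_logb hγ hτ hγn h
            linarith
          · have e1 : (n : ℝ) ≤ ((k : ℝ) + 1) * (8 * γ * τ + 1) := by
              exact_mod_cast (not_le.mp hS).le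
            have := htab h
            linarith
        have hnc : ((n / c : ℕ) : ℝ) ≤ n := by exact_mod_cast Nat.div_le_self n c
        rw [WordRAM.Layout.words_data]
        simp only [WordRAM.plainLayout]
        push_cast at hnc ⊢
        linarith

theorem mainTheorem4 :
    ∃ (P : WordRAM.Program) (C : ℝ), 0 < C ∧
      ∀ (w n σ τ : ℕ) (T : Fin n → Fin σ) (Γ : Finset (Fin n)),
        1 ≤ n → n < 2 ^ w → σ ≤ 2 ^ w → 2 ≤ τ → IsStringAttractor T Γ →
        ∃ D : WordRAM.Data w,
          (D.words : ℝ) ≤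
            C * ((Γ.card : ℝ) + (Γ.card : ℝ) * τ * Real.logb τ ((n : ℝ) / Γ.card)) ∧
          ∀ (i ℓ : ℕ) (h : i + ℓ ≤ n),
            WordRAM.ExtractsWithin P D T i ℓ h
              (C * (1 + Real.logb τ ((n : ℝ) / Γ.card) + ℓ * Real.logb 2 σ / w)) := by
  refine ⟨WordRAM.extractProgram, 108, by norm_num, ?_⟩
  intro w n σ τ T Γ hn1 hn hσw hτ hΓ
  have hγ := hΓ.card_pos hn1
  have hγn : Γ.card ≤ n := by simpa using Γ.card_le_univ
  have hx0 := le_logb_of_mul_pow_le (k := 0) hγ hτ (by simpa using hγn)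
  rw [Nat.cast_zero] at hx0
  have hspace : 0 ≤ (Γ.card : ℝ) + (Γ.card : ℝ) * τ * Real.logb τ ((n : ℝ) / Γ.card) := by
    positivity
  have hσ0 : 0 < σ := (T ⟨0, hn1⟩).pos
  rcases Nat.eq_or_lt_of_le (Nat.succ_le_of_lt hσ0) with rfl | hσ
  · refine ⟨[], ?_, fun i ℓ h => WordRAM.extractsWithin_nil T h ?_⟩
    · simp only [WordRAM.Data.words, List.map_nil, List.sum_nil, Nat.cast_zero]
      linarith
    · simp only [Nat.succ_eq_add_one, zero_add, Nat.cast_one, Real.logb_one, mul_zero, zero_div]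
      linarith
  · obtain ⟨X, hX, hc, hb, hv, hL, hwords⟩ := exists_layout hΓ hn1 hn hσ hσw hτ
    refine ⟨X.data w, hwords.trans (by linarith), fun i ℓ h => hX.extractsWithin hc hb h ?_⟩
    have hℓ := div_charsPerWord_le (ℓ := ℓ) hσ hσw
    -- a chunk has `L + 1` words, so the descents cost no more than the output, up to one descent
    have hsteps : (ℓ / X.c / X.v + 1) * (9 * X.L + 9) + 18 * (ℓ / X.c + 1) + 16
        ≤ 27 * (ℓ / X.c) + 9 * X.L + 43 := by
      have h1 : ℓ / X.c / (X.L + 1) * (X.L + 1) ≤ ℓ / X.c := Nat.div_mul_le_self _ _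
      rw [hv]
      calc _ = 9 * (ℓ / X.c / (X.L + 1) * (X.L + 1)) + 9 * X.L + 18 * (ℓ / X.c) + 43 := by ring
        _ ≤ _ := by omega
    refine (Nat.cast_le.mpr hsteps).trans ?_
    rw [hc]
    have hℓ0 : (0 : ℝ) ≤ ((ℓ / WordRAM.charsPerWord w σ : ℕ) : ℝ) := Nat.cast_nonneg _
    push_cast at hℓ hℓ0 ⊢
    linarith
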